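/- All manifolds are finite-dimensional, smooth ($C^\infty$), real, without boundary, Hausdorff and paracompact. Let $G$ be a Lie group with Lie algebra $\mathfrak g=T_eG$, and let $\pi:P\to M$ be a smooth principal $G$-bundle with right action $(p,g)\mapsto p\cdot g=R_g(p)$. For $v\in T_gG$ write $v\cdot g^{-1}\in\mathfrak g$ for the image of $v$ under the differential of right translation by $g^{-1}$. A trivialization over an open set $U\subset M$ is a diffeomorphism $h_U:\pi^{-1}(U)\to U\times G$ over $U$ that commutes with the right actions of $G$. Two trivializations $h_U,h_V$ define the smooth map $g_{VU}:U\cap V\to G$ by $h_V\circ h_U^{-1}(x,h)=(x,g_{VU}(x)h)$. A connection on $P$ is a choice, for every $p\in P$, of a subspace $H_p\subset T_pP$ complementary to $V_p=\ker d\pi_p$, such that for every smooth vector field on an open subset of $P$ its projection to $H$ along $V$ is smooth. It is invariant if $H_{p\cdot g}=dR_g(H_p)$ for all $p\in P$, $g\in G$. Its connection form $\omega_p:T_pP\to\mathfrak g$ is the projection onto $V_p$ along $H_p$ followed by the inverse of the isomorphism $\mathfrak g\to V_p$, $L\mapsto\frac{d}{dt}\big|_{t=0}\,p\cdot\exp(tL)$.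 An invariant connection is said to have local gauge potential $A_U$, a $\mathfrak g$-valued $1$-form on $U$, in the trivialization $h_U$ if $$\big((h_U^{-1})^*\omega\big)_{(x,h)}(\xi,w)=\mathrm{Ad}_{h^{-1}}\big(A_U(x)\xi+w\cdot h^{-1}\big)$$ for all $x\in U$, $h\in G$, $\xi\in T_xM$, $w\in T_hG$. **Theorem.** Suppose given a family of trivializations $h_U:\pi^{-1}(U)\to U\times G$ of $P$ whose open sets $U$ cover $M$ (different members of the family may have the same $U$) and, for each of them, a smooth $\mathfrak g$-valued $1$-form $A_U$ on $U$, such that for every pair of members $$A_V=\mathrm{Ad}_{g_{VU}}A_U-dg_{VU}\cdot g_{VU}^{-1}\qquad\text{on }U\cap V.$$ Then there is a unique invariant connection on $P$ whose local gauge potential in the trivialization $h_U$ is $A_U$, for every member of the family. -/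

import Mathlib

open scoped Manifold ContDiff
open Bundle

noncomputable section

/-! Standing notation: `M` is the base manifold, `G` the structure group, `P` the total space; all of
them are smooth (`C^∞`) real manifolds. -/

section LieGroupOperations

variable {EG : Type*} [NormedAddCommGroup EG] [NormedSpace ℝ EG]
  {HG : Type*} [TopologicalSpace HG] (IG : ModelWithCorners ℝ EG HG)
  {G : Type*} [TopologicalSpace G] [ChartedSpace HG G] [Group G]

/-- The adjoint map `Ad_g : 𝔤 → 𝔤`, `L ↦ g · L · g⁻¹`, i.e. the differential at the identity of
`h ↦ g * h * g⁻¹` (the target is `T_{g * 1 * g⁻¹} G = T_1 G`). -/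
def adjointMap (g : G) : GroupLieAlgebra IG G →L[ℝ] GroupLieAlgebra IG G :=
  mfderiv IG IG (fun h : G => g * h * g⁻¹) 1

/-- The map `T_g G → 𝔤`, `v ↦ v · g⁻¹`, i.e. the differential at `g` of the right translation
`h ↦ h * g⁻¹` (the target is `T_{g * g⁻¹} G = T_1 G`). -/
def rightTrivialize (g : G) : TangentSpace IG g →L[ℝ] GroupLieAlgebra IG G :=
  mfderiv IG IG (fun h : G => h * g⁻¹) g

end LieGroupOperations

variable {EM : Type*} [NormedAddCommGroup EM] [NormedSpace ℝ EM]
  {HM : Type*} [TopologicalSpace HM] (IM : ModelWithCorners ℝ EM HM)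
  {EG : Type*} [NormedAddCommGroup EG] [NormedSpace ℝ EG]
  {HG : Type*} [TopologicalSpace HG] (IG : ModelWithCorners ℝ EG HG)
  {EP : Type*} [NormedAddCommGroup EP] [NormedSpace ℝ EP]
  {HP : Type*} [TopologicalSpace HP] (IP : ModelWithCorners ℝ EP HP)
  (M : Type*) [TopologicalSpace M] [ChartedSpace HM M]
  (G : Type*) [TopologicalSpace G] [ChartedSpace HG G] [Group G]
  (P : Type*) [TopologicalSpace P] [ChartedSpace HP P]

/-- A (local) trivialization `h_U : π⁻¹(U) → U × G` of `proj : P → M`, where `act` is a right action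
of `G` on `P`: a homeomorphism over the open set `U = baseSet`, smooth in both directions, which
commutes with the right action. -/
structure EquivariantTrivialization (proj : P → M) (act : P → G → P) extends
    Trivialization G proj where
  contMDiffOn_toFun :
    ContMDiffOn IP (IM.prod IG) ∞ toOpenPartialHomeomorph toOpenPartialHomeomorph.source
  contMDiffOn_symm :
    ContMDiffOn (IM.prod IG) IP ∞ toOpenPartialHomeomorph.symm toOpenPartialHomeomorph.target
  equivariant : ∀ p ∈ toOpenPartialHomeomorph.source, ∀ g : G,
    (toOpenPartialHomeomorph (act p g)).2 = (toOpenPartialHomeomorph p).2 * g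

/-- A smooth principal `G`-bundle over `M` with total space `P`. -/
structure PrincipalBundle where
  /-- The projection `π : P → M`. -/
  proj : P → M
  /-- The right action `(p, g) ↦ p · g`. -/
  act : P → G → P
  act_one : ∀ p, act p 1 = p
  act_mul : ∀ p g h, act p (g * h) = act (act p g) h
  contMDiff_proj : ContMDiff IP IM ∞ proj
  contMDiff_act : ContMDiff (IP.prod IG) IP ∞ (fun q : P × G => act q.1 q.2)
  proj_act : ∀ p g, proj (act p g) = proj p
  locally_trivial : ∀ x : M,
    ∃ e : EquivariantTrivialization IM IG IP M G P proj act, x ∈ e.baseSet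

variable {IM IG IP M G P}

namespace PrincipalBundle

/-- The trivializations of a principal bundle. -/
abbrev Triv (B : PrincipalBundle IM IG IP M G P) : Type _ :=
  EquivariantTrivialization IM IG IP M G P B.proj B.act

/-- The transition function `g_{VU} : U ∩ V → G` of the trivializations `h_U` and `h_V`, defined by
`h_V (h_U⁻¹ (x, 1)) = (x, g_{VU} x)`; its values outside `U ∩ V` are irrelevant. -/
def transition (B : PrincipalBundle IM IG IP M G P) (hV hU : B.Triv) (x : M) : G :=
  (hV.toOpenPartialHomeomorph (hU.toOpenPartialHomeomorph.symm (x, 1))).2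

/-- `h_V ∘ h_U⁻¹` is `(x, h) ↦ (x, g_{VU}(x) * h)`. -/
theorem transition_spec (B : PrincipalBundle IM IG IP M G P) (hV hU : B.Triv) (x : M)
    (hxU : x ∈ hU.baseSet) (hxV : x ∈ hV.baseSet) (h : G) :
    hV.toOpenPartialHomeomorph (hU.toOpenPartialHomeomorph.symm (x, h)) =
      (x, B.transition hV hU x * h) := by
  have key : ∀ k : G, hU.toOpenPartialHomeomorph.symm (x, k) ∈ hU.source ∧
      hU.toOpenPartialHomeomorph (hU.toOpenPartialHomeomorph.symm (x, k)) = (x, k) := by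
    intro k
    have hk : (x, k) ∈ hU.target := by rw [hU.target_eq]; exact ⟨hxU, trivial⟩
    exact ⟨hU.map_target hk, hU.right_inv hk⟩
  have hproj : ∀ k : G, B.proj (hU.toOpenPartialHomeomorph.symm (x, k)) = x := by
    intro k
    rw [← hU.proj_toFun _ (key k).1]
    exact congrArg Prod.fst (key k).2
  set p := hU.toOpenPartialHomeomorph.symm (x, (1 : G)) with hp
  have hact : B.act p h = hU.toOpenPartialHomeomorph.symm (x, h) := by
    have hs : B.act p h ∈ hU.source := by
      rw [hU.source_eq, Set.mem_preimage, B.proj_act, hproj]; exact hxU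
    apply hU.injOn hs (key h).1
    refine Eq.trans ?_ (key h).2.symm
    refine Prod.ext ?_ ?_
    · exact (hU.proj_toFun _ hs).trans (by rw [B.proj_act, hproj])
    · refine (hU.equivariant p (key 1).1 h).trans ?_
      rw [(key 1).2, one_mul]
  have hpV : p ∈ hV.source := by
    rw [hV.source_eq, Set.mem_preimage, hproj]; exact hxV
  rw [← hact]
  refine Prod.ext ?_ ?_
  · have hs : B.act p h ∈ hV.source := by
      rw [hV.source_eq, Set.mem_preimage, B.proj_act, hproj]; exact hxV
    exact (hV.proj_toFun _ hs).trans (by rw [B.proj_act, hproj])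
  · exact hV.equivariant p hpV h

/-- The vertical subspace `V_p P = ker dπ_p` of `T_p P`. -/
def vertical (B : PrincipalBundle IM IG IP M G P) (p : P) : Submodule ℝ (TangentSpace IP p) :=
  (mfderiv IP IM B.proj p).ker

/-- The map `𝔤 → T_p P`, `L ↦ L_p`, where `L_p` is the velocity at `0` of `t ↦ p · exp (t L)`; by the
chain rule this is the differential at `1` of the orbit map `g ↦ p · g`
(the target is `T_{p · 1} P = T_p P`). -/
def fundamental (B : PrincipalBundle IM IG IP M G P) (p : P) :
    GroupLieAlgebra IG G →L[ℝ] TangentSpace IP p :=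
  mfderiv IG IP (fun g : G => B.act p g) 1

/-- The differential `v ↦ v · g` of the right translation `R_g : p ↦ p · g`. -/
def dRight (B : PrincipalBundle IM IG IP M G P) (g : G) (p : P) :
    TangentSpace IP p →L[ℝ] TangentSpace IP (B.act p g) :=
  mfderiv IP IP (fun q : P => B.act q g) p

theorem contMDiff_orbit (B : PrincipalBundle IM IG IP M G P) (p : P) :
    ContMDiff IG IP ∞ (fun g : G => B.act p g) :=
  B.contMDiff_act.comp (contMDiff_const.prodMk contMDiff_id)

theorem fundamental_mem_vertical (B : PrincipalBundle IM IG IP M G P) (p : P)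
    (L : GroupLieAlgebra IG G) : B.fundamental p L ∈ B.vertical p := by
  have h1 : MDifferentiableAt IG IP (fun g : G => B.act p g) 1 :=
    (B.contMDiff_orbit p).mdifferentiableAt (by simp)
  have h2 : MDifferentiableAt IP IM B.proj (B.act p 1) :=
    B.contMDiff_proj.mdifferentiableAt (by simp)
  have h3 := mfderiv_comp (1 : G) h2 h1
  have h4 : B.proj ∘ (fun g : G => B.act p g) = fun _ => B.proj p := by
    funext g; exact B.proj_act p g
  rw [h4, mfderiv_const] at h3
  have h5 : ∀ q : P, q = p → ∀ w : EP,
      (mfderiv IP IM B.proj q : EP → EM) w = (mfderiv IP IM B.proj p : EP → EM) w := by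
    rintro q rfl w; rfl
  have h6 := DFunLike.congr_fun h3 L
  exact (h5 _ (B.act_one p) _).symm.trans h6.symm

theorem fundamental_injective [LieGroup IG ∞ G] (B : PrincipalBundle IM IG IP M G P) (p : P) :
    Function.Injective (B.fundamental p) := by
  obtain ⟨e, he⟩ := B.locally_trivial (B.proj p)
  have hs : ∀ q, B.proj q = B.proj p → q ∈ e.source := by
    intro q hq
    rw [e.source_eq, Set.mem_preimage, hq]; exact he
  set a := (e.toOpenPartialHomeomorph p).2 with ha
  have h1 : MDifferentiableAt IG IP (fun g : G => B.act p g) 1 :=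
    (B.contMDiff_orbit p).mdifferentiableAt (by simp)
  have h2 : MDifferentiableAt IP IG
      (fun q => a⁻¹ * (e.toOpenPartialHomeomorph q).2) (B.act p 1) := by
    have h3 : ContMDiffAt IP (IM.prod IG) ∞ e.toOpenPartialHomeomorph (B.act p 1) :=
      e.contMDiffOn_toFun.contMDiffAt (e.open_source.mem_nhds (hs _ (B.proj_act p 1)))
    have h4 : ContMDiffAt IP IG ∞ (fun q => a⁻¹ * (e.toOpenPartialHomeomorph q).2) (B.act p 1) :=
      (contMDiff_mul_left (I := IG) (n := ∞) (a := a⁻¹)).contMDiffAt.comp _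
        (contMDiffAt_snd.comp _ h3)
    exact h4.mdifferentiableAt (by simp)
  have h3 := mfderiv_comp (1 : G) h2 h1
  have h4 : (fun q => a⁻¹ * (e.toOpenPartialHomeomorph q).2) ∘ (fun g : G => B.act p g) = id := by
    funext g
    have h := e.equivariant p (hs p rfl) g
    simp only [Function.comp_apply, id_eq]
    rw [h, inv_mul_cancel_left]
  rw [h4, mfderiv_id] at h3
  intro L K hLK
  have hL := DFunLike.congr_fun h3 L
  have hK := DFunLike.congr_fun h3 K
  refine Eq.trans hL (Eq.trans ?_ hK.symm)
  exact congrArg (fun w : EP => (mfderiv IP IG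
    (fun q => a⁻¹ * (e.toOpenPartialHomeomorph q).2) (B.act p 1) : EP → EG) w) hLK

theorem exists_fundamental_eq [LieGroup IG ∞ G] [IsManifold IM ∞ M] [IsManifold IP ∞ P]
    (B : PrincipalBundle IM IG IP M G P) (p : P) (v : TangentSpace IP p) (hv : v ∈ B.vertical p) :
    ∃ L, B.fundamental p L = v := by
  obtain ⟨e, he⟩ := B.locally_trivial (B.proj p)
  have hs : ∀ q, B.proj q = B.proj p → q ∈ e.source := by
    intro q hq
    rw [e.source_eq, Set.mem_preimage, hq]; exact he
  have hp := hs p rfl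
  set a := (e.toOpenPartialHomeomorph p).2 with ha
  have hep : e.toOpenPartialHomeomorph p = (B.proj p, a) := Prod.ext (e.proj_toFun p hp) rfl
  have het : ∀ b : G, (B.proj p, b) ∈ e.target := by
    intro b; rw [e.target_eq]; exact ⟨he, trivial⟩
  have hsymm : ∀ b : G, e.toOpenPartialHomeomorph.symm (B.proj p, b) = B.act p (a⁻¹ * b) := by
    intro b
    apply e.injOn (e.map_target (het b)) (hs _ (B.proj_act _ _))
    refine (e.right_inv (het b)).trans (Prod.ext ?_ ?_)
    · exact ((e.proj_toFun _ (hs _ (B.proj_act _ _))).trans (B.proj_act _ _)).symm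
    · refine ((e.equivariant p hp _).trans ?_).symm
      exact mul_inv_cancel_left a b
  have hed : MDifferentiableAt IP (IM.prod IG) e.toOpenPartialHomeomorph p :=
    (e.contMDiffOn_toFun.contMDiffAt (e.open_source.mem_nhds hp)).mdifferentiableAt (by simp)
  have hsd : MDifferentiableAt (IM.prod IG) IP e.toOpenPartialHomeomorph.symm (B.proj p, a) :=
    (e.contMDiffOn_symm.contMDiffAt (e.open_target.mem_nhds (het a))).mdifferentiableAt (by simp)
  have hsd' : MDifferentiableAt (IM.prod IG) IP e.toOpenPartialHomeomorph.symm
      (e.toOpenPartialHomeomorph p) := by rw [hep]; exact hsd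
  set u : TangentSpace (IM.prod IG) (e.toOpenPartialHomeomorph p) :=
    mfderiv IP (IM.prod IG) e.toOpenPartialHomeomorph p v with hu
  -- the base component of `u` vanishes
  have hu1 : (show EM × EG from u).1 = 0 := by
    have h1 := mfderiv_comp p (mdifferentiableAt_fst (I := IM) (I' := IG)
      (x := e.toOpenPartialHomeomorph p)) hed
    have h2 : (Prod.fst ∘ e.toOpenPartialHomeomorph) =ᶠ[nhds p] B.proj := by
      filter_upwards [e.open_source.mem_nhds hp] with q hq using e.proj_toFun q hq
    rw [h2.mfderiv_eq, mfderiv_fst] at h1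
    have h3 := DFunLike.congr_fun h1 v
    exact h3.symm.trans hv
  -- `v` is the image of `u` under the inverse of the trivialization
  have hv1 : (mfderiv (IM.prod IG) IP e.toOpenPartialHomeomorph.symm
      (e.toOpenPartialHomeomorph p) u : EP) = v := by
    have h1 := mfderiv_comp p hsd' hed
    have h2 : (e.toOpenPartialHomeomorph.symm ∘ e.toOpenPartialHomeomorph) =ᶠ[nhds p] id := by
      filter_upwards [e.open_source.mem_nhds hp] with q hq using e.left_inv hq
    rw [h2.mfderiv_eq, mfderiv_id] at h1
    exact (DFunLike.congr_fun h1 v).symm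
  have hmul : MDifferentiableAt IG IG (fun b : G => a⁻¹ * b) a :=
    (contMDiff_mul_left (I := IG) (n := ∞) (a := a⁻¹)).mdifferentiableAt (by simp)
  have horb : ∀ b, MDifferentiableAt IG IP (fun g : G => B.act p g) b := fun b =>
    (B.contMDiff_orbit p).mdifferentiableAt (by simp)
  have hfib : ∀ w : EG, (mfderiv (IM.prod IG) IP e.toOpenPartialHomeomorph.symm
      (B.proj p, a) : EM × EG → EP) (0, w) =
      (mfderiv IG IP (fun g : G => B.act p g) (a⁻¹ * a) : EG → EP)
        ((mfderiv IG IG (fun b : G => a⁻¹ * b) a : EG → EG) w) := by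
    intro w
    have h1 := mfderiv_comp (I := IG) (I' := IM.prod IG) (I'' := IP) a
      (f := fun b : G => (B.proj p, b)) (g := e.toOpenPartialHomeomorph.symm) hsd
      (mdifferentiableAt_const.prodMk mdifferentiableAt_id)
    have h2 := mfderiv_comp a (horb (a⁻¹ * a)) hmul
    have h3 : e.toOpenPartialHomeomorph.symm ∘ (fun b : G => (B.proj p, b)) =
        (fun g : G => B.act p g) ∘ (fun b : G => a⁻¹ * b) := by
      funext b; exact hsymm b
    rw [h3, h2, mfderiv_prod_right] at h1
    exact (DFunLike.congr_fun h1 w).symm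
  have h5 : ∀ b : G, b = 1 → ∀ w : EG,
      (mfderiv IG IP (fun g : G => B.act p g) b : EG → EP) w =
        (mfderiv IG IP (fun g : G => B.act p g) 1 : EG → EP) w := by
    rintro b rfl w; rfl
  have h6 : ∀ y : M × G, y = (B.proj p, a) → ∀ w : EM × EG,
      (mfderiv (IM.prod IG) IP e.toOpenPartialHomeomorph.symm y : EM × EG → EP) w =
        (mfderiv (IM.prod IG) IP e.toOpenPartialHomeomorph.symm (B.proj p, a)
          : EM × EG → EP) w := by
    rintro y rfl w; rfl
  refine ⟨(mfderiv IG IG (fun b : G => a⁻¹ * b) a : EG → EG) (show EM × EG from u).2, ?_⟩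
  have h7 : (show EM × EG from u) = (0, (show EM × EG from u).2) := Prod.ext hu1 rfl
  refine Eq.trans ?_ hv1
  refine Eq.trans ?_ (h6 _ hep (show EM × EG from u)).symm
  rw [h7, hfib]
  exact (h5 _ (inv_mul_cancel a) _).symm

/-- The canonical identification `𝔤 ≃ V_p P`, `L ↦ L_p`. -/
def verticalEquiv [LieGroup IG ∞ G] [IsManifold IM ∞ M] [IsManifold IP ∞ P]
    (B : PrincipalBundle IM IG IP M G P) (p : P) :
    GroupLieAlgebra IG G ≃ₗ[ℝ] B.vertical p :=
  LinearEquiv.ofBijective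
    ((B.fundamental p).toLinearMap.codRestrict (B.vertical p) (B.fundamental_mem_vertical p))
    ⟨fun _ _ h => B.fundamental_injective p (congrArg Subtype.val h),
      fun v => (B.exists_fundamental_eq p v.1 v.2).imp fun _ h => Subtype.ext h⟩

/-- A connection on a principal bundle: a smooth choice of complements `H_p P` of the vertical
subspaces. Smoothness means that for every `C^∞` vector field `X` on an open subset of `P`, the
horizontally projected field `π^h X` is again `C^∞`. -/
@[ext]
structure Connection [IsManifold IP ∞ P] (B : PrincipalBundle IM IG IP M G P) where
  /-- The horizontal subspaces. -/
  horizontal : ∀ p : P, Submodule ℝ (TangentSpace IP p)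
  isCompl : ∀ p, IsCompl (horizontal p) (B.vertical p)
  smooth : ∀ (W : Set P) (X : ∀ p : P, TangentSpace IP p), IsOpen W →
    ContMDiffOn IP IP.tangent ∞ (fun p => (⟨p, X p⟩ : TangentBundle IP P)) W →
    ContMDiffOn IP IP.tangent ∞ (fun p =>
      (⟨p, (horizontal p).projection (B.vertical p) (isCompl p) (X p)⟩ : TangentBundle IP P)) W

namespace Connection

variable [IsManifold IP ∞ P] {B : PrincipalBundle IM IG IP M G P}

/-- A connection is invariant if `H_{p · g} = H_p · g`. -/
def IsInvariant (C : B.Connection) : Prop :=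
  ∀ (p : P) (g : G),
    C.horizontal (B.act p g) = (C.horizontal p).map (B.dRight g p).toLinearMap

variable [LieGroup IG ∞ G] [IsManifold IM ∞ M]

/-- The connection `1`-form `ω_p : T_p P → 𝔤`: the vertical projection along the horizontal
subspace, followed by the identification of `V_p P` with `𝔤`. -/
def form (C : B.Connection) (p : P) : TangentSpace IP p →ₗ[ℝ] GroupLieAlgebra IG G :=
  (B.verticalEquiv p).symm.toLinearMap ∘ₗ
    (B.vertical p).projectionOnto (C.horizontal p) (C.isCompl p).symm

/-- The pull-back `ω^U = (h_U⁻¹)^* ω` of the connection `1`-form to `U × G`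
(only meaningful at points `y ∈ U × G`). -/
def localForm (C : B.Connection) (hU : B.Triv) (y : M × G) :
    TangentSpace (IM.prod IG) y →ₗ[ℝ] GroupLieAlgebra IG G :=
  C.form (hU.toOpenPartialHomeomorph.symm y) ∘ₗ
    (mfderiv (IM.prod IG) IP hU.toOpenPartialHomeomorph.symm y).toLinearMap

/-- `C` is represented in the trivialization `h_U` by the `𝔤`-valued `1`-form `A` on `U`, i.e. `A` is
its local gauge potential: for `x ∈ U`, `ξ ∈ T_x M`, `h ∈ G`, `w ∈ T_h G`,
`ω^U_{(x,h)} (ξ, w) = Ad_{h⁻¹} (A_x ξ + w · h⁻¹)`. -/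
def IsRepresentedBy (C : B.Connection) (hU : B.Triv)
    (A : ∀ x : M, TangentSpace IM x →L[ℝ] GroupLieAlgebra IG G) : Prop :=
  ∀ x ∈ hU.baseSet, ∀ (h : G) (ξ : TangentSpace IM x) (w : TangentSpace IG h),
    C.localForm hU (x, h) (ξ, w) = adjointMap IG h⁻¹ (A x ξ + rightTrivialize IG h w)

end Connection

end PrincipalBundle

/-- A `𝔤`-valued `1`-form, given by its values `A x : T_x M → 𝔤`, is smooth on the open set `U`:
the map `(x, ξ) ↦ A_x ξ` is smooth on the tangent bundle over `U`. -/
def IsSmoothOneFormOn (A : ∀ x : M, TangentSpace IM x →L[ℝ] GroupLieAlgebra IG G)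
    (U : Set M) [IsManifold IM ∞ M] : Prop :=
  ContMDiffOn IM.tangent 𝓘(ℝ, EG) ∞
    (fun v : TangentBundle IM M => (show EG from A v.proj v.2)) (TotalSpace.proj ⁻¹' U)

/-- The transformation law `A_V = Ad_{g_{VU}} A_U - dg_{VU} · g_{VU}⁻¹` on `U ∩ V`. -/
def GaugeCompatible (B : PrincipalBundle IM IG IP M G P) (hV hU : B.Triv)
    (AV AU : ∀ x : M, TangentSpace IM x →L[ℝ] GroupLieAlgebra IG G) : Prop :=
  ∀ x ∈ hU.baseSet ∩ hV.baseSet, ∀ ξ : TangentSpace IM x,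
    AV x ξ = adjointMap IG (B.transition hV hU x) (AU x ξ) -
      rightTrivialize IG (B.transition hV hU x) (mfderiv IM IG (B.transition hV hU) x ξ)

end

noncomputable section

/-! A connection is determined by its form, since `H_p` is the kernel of `ω_p`. Over `U` write `a`
for the fibre coordinate of `p` and `x = π p`. The local formula for `ω`, pulled back by `h_U`, says
`ω_p = Ad_{a⁻¹} (A_U dπ + da · a⁻¹)`, which is `gaugeForm`. The potentials thus fix `ω`
(`IsRepresentedBy.form_apply`), whence uniqueness.

For existence this formula is taken as the definition of `ω`. It does not depend on the member of
the family: with `t = g_{VU}` the coordinates satisfy `a' = t a`, so `da' · a'⁻¹ = dt · t⁻¹ + Ad_t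
(da · a⁻¹)`, and the term `-dt · t⁻¹` in the gauge law cancels the first summand
(`gaugeForm_eq_of_gaugeCompatible`). The form inverts `L ↦ L_p` (`gaugeForm_fundamental`), is
equivariant (`gaugeForm_act`) and smooth (`contMDiffOn_gaugeForm`), so its kernels form an invariant
connection (`ofForm`, `isInvariant_of_form`). -/

theorem Submodule.projection_eq_sub_of_mem {R E : Type*} [Ring R] [AddCommGroup E] [Module R E]
    {p q : Submodule R E} (hpq : IsCompl p q) {x y : E} (hx : x - y ∈ p) (hy : y ∈ q) :
    p.projection q hpq x = x - y := by
  conv_lhs => rw [← sub_add_cancel x y]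
  rw [map_add, Submodule.projection_apply_of_mem_left hpq hx,
    Submodule.projection_apply_of_mem_right hpq hy, add_zero]

/-! ### Differentials between model spaces, and smoothness in tangent bundles -/

section ModelDerivative

variable {E₁ : Type*} [NormedAddCommGroup E₁] [NormedSpace ℝ E₁]
  {H₁ : Type*} [TopologicalSpace H₁] {I₁ : ModelWithCorners ℝ E₁ H₁}
  {E₂ : Type*} [NormedAddCommGroup E₂] [NormedSpace ℝ E₂]
  {H₂ : Type*} [TopologicalSpace H₂] {I₂ : ModelWithCorners ℝ E₂ H₂}
  {E₃ : Type*} [NormedAddCommGroup E₃] [NormedSpace ℝ E₃]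
  {H₃ : Type*} [TopologicalSpace H₃] {I₃ : ModelWithCorners ℝ E₃ H₃}
  {M₁ : Type*} [TopologicalSpace M₁] [ChartedSpace H₁ M₁]
  {M₂ : Type*} [TopologicalSpace M₂] [ChartedSpace H₂ M₂]
  {M₃ : Type*} [TopologicalSpace M₃] [ChartedSpace H₃ M₃]

variable (I₁ I₂) in
/-- The differential of `f` at `x`, seen as a map between the model spaces: its type does not
mention the base points `x` and `f x`, which can therefore be rewritten freely. -/
def modelDeriv (f : M₁ → M₂) (x : M₁) : E₁ →L[ℝ] E₂ := mfderiv I₁ I₂ f x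

/-- The separate `y` allows base points that are only propositionally equal, such as `p · 1` and
`p`. -/
theorem modelDeriv_comp {g : M₂ → M₃} {f : M₁ → M₂} {x : M₁} {y : M₂} (hxy : f x = y)
    (hg : MDifferentiableAt I₂ I₃ g y) (hf : MDifferentiableAt I₁ I₂ f x) (v : E₁) :
    modelDeriv I₁ I₃ (fun z => g (f z)) x v =
      modelDeriv I₂ I₃ g y (modelDeriv I₁ I₂ f x v) := by
  subst hxy
  exact DFunLike.congr_fun (mfderiv_comp x hg hf) v

theorem modelDeriv_congr {f g : M₁ → M₂} {x : M₁} (h : f =ᶠ[nhds x] g) :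
    modelDeriv I₁ I₂ f x = modelDeriv I₁ I₂ g x := h.mfderiv_eq

theorem modelDeriv_id (x : M₁) (v : E₁) : modelDeriv I₁ I₁ (fun z : M₁ => z) x v = v :=
  DFunLike.congr_fun (mfderiv_id (I := I₁) (x := x)) v

theorem modelDeriv_const (c : M₂) (x : M₁) (v : E₁) :
    modelDeriv I₁ I₂ (fun _ : M₁ => c) x v = 0 :=
  DFunLike.congr_fun (mfderiv_const (I := I₁) (I' := I₂) (x := x) (c := c)) v

theorem modelDeriv_fst (x : M₁ × M₂) (v : E₁ × E₂) :
    modelDeriv (I₁.prod I₂) I₁ (fun z : M₁ × M₂ => z.1) x v = v.1 :=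
  DFunLike.congr_fun (mfderiv_fst (I := I₁) (I' := I₂) (x := x)) v

theorem modelDeriv_snd (x : M₁ × M₂) (v : E₁ × E₂) :
    modelDeriv (I₁.prod I₂) I₂ (fun z : M₁ × M₂ => z.2) x v = v.2 :=
  DFunLike.congr_fun (mfderiv_snd (I := I₁) (I' := I₂) (x := x)) v

theorem modelDeriv_prodMk {f : M₁ → M₂} {g : M₁ → M₃} {x : M₁}
    (hf : MDifferentiableAt I₁ I₂ f x) (hg : MDifferentiableAt I₁ I₃ g x) (v : E₁) :
    modelDeriv I₁ (I₂.prod I₃) (fun z => (f z, g z)) x v =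
      (modelDeriv I₁ I₂ f x v, modelDeriv I₁ I₃ g x v) :=
  DFunLike.congr_fun (mfderiv_prodMk hf hg) v

theorem modelDeriv_prod_eq_add {f : M₁ × M₂ → M₃} {p : M₁ × M₂}
    (hf : MDifferentiableAt (I₁.prod I₂) I₃ f p) (v : E₁ × E₂) :
    modelDeriv (I₁.prod I₂) I₃ f p v =
      modelDeriv I₁ I₃ (fun z => f (z, p.2)) p.1 v.1 +
        modelDeriv I₂ I₃ (fun z => f (p.1, z)) p.2 v.2 :=
  mfderiv_prod_eq_add_apply hf

theorem tangentBundle_mk_congr {x y : M₁} (hxy : x = y) (v : E₁) :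
    (⟨x, v⟩ : TangentBundle I₁ M₁) = ⟨y, v⟩ := by
  subst hxy; rfl

/-- The coordinate change from the preferred chart at `y` to itself is the identity at `y`. -/
theorem trivializationAt_tangentSpace_self [IsManifold I₂ 1 M₂] (y : M₂) (v : E₂) :
    (trivializationAt E₂ (TangentSpace I₂) y (⟨y, v⟩ : TangentBundle I₂ M₂)).2 = v :=
  (tangentBundleCore I₂ M₂).coordChange_self (achart _ y) y (mem_achart_source H₂ y) v

/-- A family of tangent vectors at a fixed point is smooth as soon as it is smooth as a map to the
tangent bundle. -/
theorem contMDiffOn_fiber_of_totalSpace [IsManifold I₂ 1 M₂] {f : M₁ → E₂} {y : M₂} {s : Set M₁}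
    {n : ℕ∞ω}
    (h : ContMDiffOn I₁ I₂.tangent n (fun x => (⟨y, f x⟩ : TangentBundle I₂ M₂)) s) :
    ContMDiffOn I₁ 𝓘(ℝ, E₂) n f s := fun x hx =>
  ((contMDiffWithinAt_totalSpace).1 (h x hx)).2.congr
    (fun _ _ => (trivializationAt_tangentSpace_self y _).symm)
    (trivializationAt_tangentSpace_self y _).symm

theorem contMDiff_tangentBundle_mk [IsManifold I₂ 1 M₂] (y : M₂) {n : ℕ∞ω} :
    ContMDiff 𝓘(ℝ, E₂) I₂.tangent n (fun v : E₂ => (⟨y, v⟩ : TangentBundle I₂ M₂)) := fun _ =>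
  (contMDiffAt_totalSpace).2 ⟨contMDiffAt_const, contMDiffAt_id.congr_of_eventuallyEq
    (Filter.Eventually.of_forall fun v => trivializationAt_tangentSpace_self y v)⟩

/-- The partial differential of a smooth map of two variables in the direction of the second one
is smooth. -/
theorem contMDiff_partial_tangentMap [IsManifold I₁ 1 M₁] [IsManifold I₂ 1 M₂] [IsManifold I₃ 1 M₃]
    {f : M₁ × M₂ → M₃} (hf : ContMDiff (I₁.prod I₂) I₃ ∞ f) :
    ContMDiff (I₁.prod I₂.tangent) I₃.tangent ∞ (fun q : M₁ × TangentBundle I₂ M₂ =>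
      (⟨f (q.1, q.2.proj), modelDeriv I₂ I₃ (fun z => f (q.1, z)) q.2.proj q.2.snd⟩ :
        TangentBundle I₃ M₃)) := by
  -- A zero vector in the first factor reduces the full tangent map of `f` to the partial
  -- differential.
  have h1 : ContMDiff (I₁.prod I₂.tangent) (I₁.tangent.prod I₂.tangent) ∞
      (fun q : M₁ × TangentBundle I₂ M₂ =>
        ((zeroSection E₁ (TangentSpace I₁) q.1 : TangentBundle I₁ M₁), q.2)) :=
    ((contMDiff_zeroSection ℝ _).comp contMDiff_fst).prodMk contMDiff_snd
  have h2 := (hf.contMDiff_tangentMap (m := ∞) (by simp)).comp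
    (contMDiff_equivTangentBundleProd_symm.comp h1)
  convert h2 using 1
  funext q
  have h3 := modelDeriv_prod_eq_add (p := (q.1, q.2.proj)) (hf.mdifferentiableAt (by simp))
    ((0 : E₁), (q.2.snd : E₂))
  rw [map_zero, zero_add] at h3
  exact congrArg (fun w : E₃ => (⟨f (q.1, q.2.proj), w⟩ : TangentBundle I₃ M₃)) h3.symm

end ModelDerivative

/-! ### Calculus on the Lie group -/

section LieGroupOperations

variable {EG : Type*} [NormedAddCommGroup EG] [NormedSpace ℝ EG]
  {HG : Type*} [TopologicalSpace HG] {IG : ModelWithCorners ℝ EG HG}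
  {G : Type*} [TopologicalSpace G] [ChartedSpace HG G] [Group G]

variable (IG) in
/-- `adjointMap` as an endomorphism of the model space. -/
def modelAd (g : G) : EG →L[ℝ] EG := modelDeriv IG IG (fun z : G => g * z * g⁻¹) 1

variable (IG) in
/-- `rightTrivialize` as an endomorphism of the model space. -/
def modelRight (g : G) : EG →L[ℝ] EG := modelDeriv IG IG (fun z : G => z * g⁻¹) g

theorem modelAd_one (L : EG) : modelAd IG (1 : G) L = L := by
  have h : (fun z : G => 1 * z * 1⁻¹) = fun z => z := by funext z; simp
  rw [modelAd, h, modelDeriv_id]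

theorem modelRight_one (w : EG) : modelRight IG (1 : G) w = w := by
  have h : (fun z : G => z * 1⁻¹) = fun z => z := by funext z; simp
  rw [modelRight, h, modelDeriv_id]

variable [LieGroup IG ∞ G]

theorem mdifferentiableAt_mul_const (a b : G) : MDifferentiableAt IG IG (fun z : G => z * a) b :=
  (contMDiff_mul_right (I := IG) (n := ∞)).mdifferentiableAt (by simp)

theorem mdifferentiableAt_const_mul (a b : G) : MDifferentiableAt IG IG (fun z : G => a * z) b :=
  (contMDiff_mul_left (I := IG) (n := ∞)).mdifferentiableAt (by simp)

theorem mdifferentiableAt_conj (a b : G) :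
    MDifferentiableAt IG IG (fun z : G => a * z * a⁻¹) b :=
  ((contMDiff_mul_right (I := IG) (n := ∞) (a := a⁻¹)).comp
    (contMDiff_mul_left (I := IG) (n := ∞) (a := a))).mdifferentiableAt (by simp)

theorem modelAd_mul (g h : G) (L : EG) :
    modelAd IG (g * h) L = modelAd IG g (modelAd IG h L) := by
  have h1 := modelDeriv_comp (I₁ := IG) (I₂ := IG) (I₃ := IG) (x := (1 : G))
    (f := fun z : G => h * z * h⁻¹) (g := fun z : G => g * z * g⁻¹) (y := 1) (by simp)
    (mdifferentiableAt_conj g 1) (mdifferentiableAt_conj h 1) L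
  rw [modelAd, modelAd, modelAd, ← h1]
  congr 2
  funext z; group

theorem modelAd_inv_modelAd (g : G) (L : EG) : modelAd IG g⁻¹ (modelAd IG g L) = L := by
  rw [← modelAd_mul, inv_mul_cancel, modelAd_one]

/-- Differentiate `(g z) (g h)⁻¹ = g (z h⁻¹) g⁻¹` at `z = h`. -/
theorem modelRight_mul_left (g h : G) (w : EG) :
    modelRight IG (g * h) (modelDeriv IG IG (fun z : G => g * z) h w) =
      modelAd IG g (modelRight IG h w) := by
  rw [modelRight, modelRight, modelAd,
    ← modelDeriv_comp (by simp) (mdifferentiableAt_conj g 1) (mdifferentiableAt_mul_const _ _),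
    ← modelDeriv_comp rfl (mdifferentiableAt_mul_const _ _) (mdifferentiableAt_const_mul _ _)]
  congr 2
  funext z; group

/-- Differentiate `(z h) (g h)⁻¹ = z g⁻¹` at `z = g`. -/
theorem modelRight_mul_right (g h : G) (w : EG) :
    modelRight IG (g * h) (modelDeriv IG IG (fun z : G => z * h) g w) = modelRight IG g w := by
  rw [modelRight, modelRight,
    ← modelDeriv_comp rfl (mdifferentiableAt_mul_const _ _) (mdifferentiableAt_mul_const _ _)]
  congr 2
  funext z; group

theorem modelDeriv_mul {E₁ : Type*} [NormedAddCommGroup E₁] [NormedSpace ℝ E₁]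
    {H₁ : Type*} [TopologicalSpace H₁] {I₁ : ModelWithCorners ℝ E₁ H₁}
    {M₁ : Type*} [TopologicalSpace M₁] [ChartedSpace H₁ M₁] {f g : M₁ → G} {x : M₁}
    (hf : MDifferentiableAt I₁ IG f x) (hg : MDifferentiableAt I₁ IG g x) (v : E₁) :
    modelDeriv I₁ IG (fun z => f z * g z) x v =
      modelDeriv IG IG (fun z : G => z * g x) (f x) (modelDeriv I₁ IG f x v) +
        modelDeriv IG IG (fun z : G => f x * z) (g x) (modelDeriv I₁ IG g x v) := by
  have hm : MDifferentiableAt (IG.prod IG) IG (fun p : G × G => p.1 * p.2) (f x, g x) :=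
    (contMDiff_mul IG ∞).mdifferentiableAt (by simp)
  rw [modelDeriv_comp (g := fun p : G × G => p.1 * p.2) (f := fun z => (f z, g z)) rfl hm
    (hf.prodMk hg), modelDeriv_prodMk hf hg, modelDeriv_prod_eq_add hm]

/-- The partial tangent map of `(g, z) ↦ z g⁻¹`, evaluated at `g = v.proj`, stays over the point
`1`; smoothness into the tangent bundle then gives smoothness into `𝔤`. -/
theorem contMDiff_modelRight :
    ContMDiff IG.tangent 𝓘(ℝ, EG) ∞
      (fun v : TangentBundle IG G => modelRight IG v.proj v.snd) := by
  have h1 : ContMDiff (IG.prod IG) IG ∞ (fun q : G × G => q.2 * q.1⁻¹) :=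
    contMDiff_snd.mul contMDiff_fst.inv
  have h2 := (contMDiff_partial_tangentMap h1).comp
    ((contMDiff_proj (TangentSpace IG)).prodMk contMDiff_id)
  rw [← contMDiffOn_univ] at h2 ⊢
  refine contMDiffOn_fiber_of_totalSpace (I₂ := IG) (y := (1 : G)) (h2.congr fun v _ =>
    tangentBundle_mk_congr (mul_inv_cancel v.proj).symm (modelRight IG v.proj v.snd))

theorem contMDiff_modelAd :
    ContMDiff (IG.prod 𝓘(ℝ, EG)) 𝓘(ℝ, EG) ∞ (fun q : G × EG => modelAd IG q.1 q.2) := by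
  have h1 : ContMDiff (IG.prod IG) IG ∞ (fun q : G × G => q.1 * q.2 * q.1⁻¹) :=
    (contMDiff_fst.mul contMDiff_snd).mul contMDiff_fst.inv
  have h2 := (contMDiff_partial_tangentMap h1).comp
    ((contMDiff_fst (I := IG) (J := 𝓘(ℝ, EG)) (M := G) (N := EG)).prodMk
      ((contMDiff_tangentBundle_mk (I₂ := IG) (1 : G)).comp contMDiff_snd))
  rw [← contMDiffOn_univ] at h2 ⊢
  refine contMDiffOn_fiber_of_totalSpace (I₂ := IG) (y := (1 : G)) (h2.congr fun v _ =>
    tangentBundle_mk_congr (by simp) (modelAd IG v.1 v.2))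

end LieGroupOperations

/-! ### Coordinates in a trivialization -/

section PrincipalBundle

variable {EM : Type*} [NormedAddCommGroup EM] [NormedSpace ℝ EM]
  {HM : Type*} [TopologicalSpace HM] {IM : ModelWithCorners ℝ EM HM}
  {EG : Type*} [NormedAddCommGroup EG] [NormedSpace ℝ EG]
  {HG : Type*} [TopologicalSpace HG] {IG : ModelWithCorners ℝ EG HG}
  {EP : Type*} [NormedAddCommGroup EP] [NormedSpace ℝ EP]
  {HP : Type*} [TopologicalSpace HP] {IP : ModelWithCorners ℝ EP HP}
  {M : Type*} [TopologicalSpace M] [ChartedSpace HM M]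
  {G : Type*} [TopologicalSpace G] [ChartedSpace HG G] [Group G]
  {P : Type*} [TopologicalSpace P] [ChartedSpace HP P]

namespace PrincipalBundle

variable (B : PrincipalBundle IM IG IP M G P)

/-- The fibre coordinate `π⁻¹(U) → G` of a trivialization. -/
def fiberCoord (e : B.Triv) (p : P) : G := (e.toOpenPartialHomeomorph p).2

variable {B}

theorem mem_source_of_proj_mem {e : B.Triv} {p : P} (hp : B.proj p ∈ e.baseSet) :
    p ∈ e.source := by
  rw [e.source_eq]; exact hp

theorem mem_target_of_fst_mem {e : B.Triv} {y : M × G} (hy : y.1 ∈ e.baseSet) :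
    y ∈ e.target := by
  rw [e.target_eq]; exact ⟨hy, trivial⟩

theorem apply_eq_fiberCoord {e : B.Triv} {p : P} (hp : B.proj p ∈ e.baseSet) :
    e.toOpenPartialHomeomorph p = (B.proj p, B.fiberCoord e p) :=
  Prod.ext (e.proj_toFun p (mem_source_of_proj_mem hp)) rfl

theorem proj_symm_apply {e : B.Triv} {y : M × G} (hy : y.1 ∈ e.baseSet) :
    B.proj (e.toOpenPartialHomeomorph.symm y) = y.1 := by
  have ht := mem_target_of_fst_mem hy
  rw [← e.proj_toFun _ (e.map_target ht)]
  exact congrArg Prod.fst (e.right_inv ht)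

theorem fiberCoord_symm_apply {e : B.Triv} {y : M × G} (hy : y.1 ∈ e.baseSet) :
    B.fiberCoord e (e.toOpenPartialHomeomorph.symm y) = y.2 :=
  congrArg Prod.snd (e.right_inv (mem_target_of_fst_mem hy))

theorem fiberCoord_act {e : B.Triv} {p : P} (hp : B.proj p ∈ e.baseSet) (g : G) :
    B.fiberCoord e (B.act p g) = B.fiberCoord e p * g :=
  e.equivariant p (mem_source_of_proj_mem hp) g

theorem fiberCoord_eq_transition_mul {e e' : B.Triv} {p : P} (hp : B.proj p ∈ e.baseSet)
    (hp' : B.proj p ∈ e'.baseSet) :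
    B.fiberCoord e' p = B.transition e' e (B.proj p) * B.fiberCoord e p := by
  have h1 := congrArg Prod.snd
    (B.transition_spec e' e (B.proj p) hp hp' (B.fiberCoord e p))
  rw [← apply_eq_fiberCoord hp] at h1
  refine Eq.trans ?_ h1
  exact congrArg (fun q => (e'.toOpenPartialHomeomorph q).2)
    (e.left_inv (mem_source_of_proj_mem hp)).symm

theorem contMDiffOn_fiberCoord (e : B.Triv) :
    ContMDiffOn IP IG ∞ (B.fiberCoord e) e.source := fun p hp =>
  contMDiffAt_snd.comp_contMDiffWithinAt p (e.contMDiffOn_toFun p hp)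

theorem mdifferentiableAt_fiberCoord {e : B.Triv} {p : P} (hp : B.proj p ∈ e.baseSet) :
    MDifferentiableAt IP IG (B.fiberCoord e) p :=
  ((contMDiffOn_fiberCoord e).contMDiffAt
    (e.open_source.mem_nhds (mem_source_of_proj_mem hp))).mdifferentiableAt (by simp)

theorem mdifferentiableAt_proj (p : P) : MDifferentiableAt IP IM B.proj p :=
  B.contMDiff_proj.mdifferentiableAt (by simp)

theorem mdifferentiableAt_symm {e : B.Triv} {y : M × G} (hy : y.1 ∈ e.baseSet) :
    MDifferentiableAt (IM.prod IG) IP e.toOpenPartialHomeomorph.symm y :=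
  (e.contMDiffOn_symm.contMDiffAt
    (e.open_target.mem_nhds (mem_target_of_fst_mem hy))).mdifferentiableAt (by simp)

theorem mdifferentiableAt_transition {e e' : B.Triv} {x : M} (hx : x ∈ e.baseSet)
    (hx' : x ∈ e'.baseSet) : MDifferentiableAt IM IG (B.transition e' e) x := by
  have h1 : MDifferentiableAt IM IP (fun z => e.toOpenPartialHomeomorph.symm (z, (1 : G))) x :=
    MDifferentiableAt.comp x (mdifferentiableAt_symm (y := (x, (1 : G))) hx)
      (mdifferentiableAt_id.prodMk mdifferentiableAt_const)
  refine MDifferentiableAt.comp (f := fun z => e.toOpenPartialHomeomorph.symm (z, (1 : G))) x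
    (mdifferentiableAt_fiberCoord (e := e') ?_) h1
  rw [proj_symm_apply (y := (x, (1 : G))) hx]; exact hx'

theorem eventually_proj_mem {e : B.Triv} {p : P} (hp : B.proj p ∈ e.baseSet) :
    ∀ᶠ q in nhds p, B.proj q ∈ e.baseSet :=
  B.contMDiff_proj.continuous.continuousAt.eventually_mem (e.open_baseSet.mem_nhds hp)

theorem mdifferentiableAt_orbit (p : P) (g : G) :
    MDifferentiableAt IG IP (fun g : G => B.act p g) g :=
  (B.contMDiff_orbit p).mdifferentiableAt (by simp)

theorem mdifferentiableAt_act (g : G) (p : P) :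
    MDifferentiableAt IP IP (fun q : P => B.act q g) p :=
  (B.contMDiff_act.comp (contMDiff_id.prodMk contMDiff_const)).mdifferentiableAt (by simp)

theorem modelDeriv_proj_symm {e : B.Triv} {y : M × G} (hy : y.1 ∈ e.baseSet) (u : EM × EG) :
    modelDeriv IP IM B.proj (e.toOpenPartialHomeomorph.symm y)
      (modelDeriv (IM.prod IG) IP e.toOpenPartialHomeomorph.symm y u) = u.1 := by
  rw [← modelDeriv_comp rfl (mdifferentiableAt_proj _) (mdifferentiableAt_symm hy),
    ← modelDeriv_fst (I₁ := IM) (I₂ := IG) y u]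
  refine congrArg (fun D : EM × EG →L[ℝ] EM => D u) (modelDeriv_congr ?_)
  filter_upwards [e.open_target.mem_nhds (mem_target_of_fst_mem hy)] with z hz
  rw [e.target_eq] at hz
  exact proj_symm_apply hz.1

theorem modelDeriv_fiberCoord_symm {e : B.Triv} {y : M × G} (hy : y.1 ∈ e.baseSet)
    (u : EM × EG) :
    modelDeriv IP IG (B.fiberCoord e) (e.toOpenPartialHomeomorph.symm y)
      (modelDeriv (IM.prod IG) IP e.toOpenPartialHomeomorph.symm y u) = u.2 := by
  rw [← modelDeriv_comp rfl
      (mdifferentiableAt_fiberCoord (by rw [proj_symm_apply hy]; exact hy))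
      (mdifferentiableAt_symm hy),
    ← modelDeriv_snd (I₁ := IM) (I₂ := IG) y u]
  refine congrArg (fun D : EM × EG →L[ℝ] EG => D u) (modelDeriv_congr ?_)
  filter_upwards [e.open_target.mem_nhds (mem_target_of_fst_mem hy)] with z hz
  rw [e.target_eq] at hz
  exact fiberCoord_symm_apply hz.1

/-- Differentiate `h_U⁻¹ ∘ h_U = id` near `p`. Every tangent vector at `p` is thereby the image of a
pair `(ξ, w)`, the input of the gauge potential formula. -/
theorem modelDeriv_symm_apply {e : B.Triv} {p : P} (hp : B.proj p ∈ e.baseSet) (v : EP) :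
    modelDeriv (IM.prod IG) IP e.toOpenPartialHomeomorph.symm (B.proj p, B.fiberCoord e p)
      (modelDeriv IP IM B.proj p v, modelDeriv IP IG (B.fiberCoord e) p v) = v := by
  rw [← modelDeriv_prodMk (mdifferentiableAt_proj p) (mdifferentiableAt_fiberCoord hp),
    ← modelDeriv_comp (f := fun z => (B.proj z, B.fiberCoord e z)) rfl
      (mdifferentiableAt_symm hp)
      ((mdifferentiableAt_proj p).prodMk (mdifferentiableAt_fiberCoord hp)),
    modelDeriv_congr (g := fun q : P => q) ?_, modelDeriv_id]
  filter_upwards [eventually_proj_mem hp] with q hq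
  rw [← apply_eq_fiberCoord hq]
  exact e.left_inv (mem_source_of_proj_mem hq)

/-! ### The local connection forms -/

variable (B) in
/-- The connection form on `π⁻¹(U)` with gauge potential `A` in the trivialization `e`. -/
def gaugeForm (e : B.Triv) (A : M → EM →L[ℝ] EG) (p : P) : EP →L[ℝ] EG :=
  modelAd IG (B.fiberCoord e p)⁻¹ ∘L
    (A (B.proj p) ∘L modelDeriv IP IM B.proj p +
      modelRight IG (B.fiberCoord e p) ∘L modelDeriv IP IG (B.fiberCoord e) p)

theorem gaugeForm_apply (e : B.Triv) (A : M → EM →L[ℝ] EG) (p : P) (v : EP) :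
    B.gaugeForm e A p v = modelAd IG (B.fiberCoord e p)⁻¹
      (A (B.proj p) (modelDeriv IP IM B.proj p v) +
        modelRight IG (B.fiberCoord e p) (modelDeriv IP IG (B.fiberCoord e) p v)) := rfl

theorem gaugeForm_symm {e : B.Triv} (A : M → EM →L[ℝ] EG) {y : M × G} (hy : y.1 ∈ e.baseSet)
    (u : EM × EG) :
    B.gaugeForm e A (e.toOpenPartialHomeomorph.symm y)
      (modelDeriv (IM.prod IG) IP e.toOpenPartialHomeomorph.symm y u) =
      modelAd IG y.2⁻¹ (A y.1 u.1 + modelRight IG y.2 u.2) := by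
  rw [gaugeForm_apply, modelDeriv_proj_symm hy, modelDeriv_fiberCoord_symm hy,
    proj_symm_apply hy, fiberCoord_symm_apply hy]

section LieGroup

variable [LieGroup IG ∞ G]

/-- The product rule for `a' = t a` yields `dt · t⁻¹ + Ad_t (da · a⁻¹)`. Adding `A'` leaves `Ad_t`
of the bracket for `e`, and `Ad_{(t a)⁻¹} = Ad_{a⁻¹} Ad_{t⁻¹}` removes `Ad_t`. -/
theorem gaugeForm_eq_of_gaugeCompatible {e e' : B.Triv} {A A' : M → EM →L[ℝ] EG}
    (hA : GaugeCompatible B e' e A' A) {p : P} (hp : B.proj p ∈ e.baseSet)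
    (hp' : B.proj p ∈ e'.baseSet) : B.gaugeForm e' A' p = B.gaugeForm e A p := by
  ext v
  have hA' : A' (B.proj p) (modelDeriv IP IM B.proj p v) =
      modelAd IG (B.transition e' e (B.proj p)) (A (B.proj p) (modelDeriv IP IM B.proj p v)) -
        modelRight IG (B.transition e' e (B.proj p))
          (modelDeriv IM IG (B.transition e' e) (B.proj p) (modelDeriv IP IM B.proj p v)) :=
    hA _ ⟨hp, hp'⟩ _
  have hd : modelDeriv IP IG (B.fiberCoord e') p =
      modelDeriv IP IG (fun q => B.transition e' e (B.proj q) * B.fiberCoord e q) p := by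
    refine modelDeriv_congr ?_
    filter_upwards [eventually_proj_mem hp, eventually_proj_mem hp'] with q hq hq'
    exact fiberCoord_eq_transition_mul hq hq'
  have ht := mdifferentiableAt_transition hp hp'
  have htp : MDifferentiableAt IP IG (fun q => B.transition e' e (B.proj q)) p :=
    ht.comp p (mdifferentiableAt_proj p)
  rw [gaugeForm_apply, gaugeForm_apply, hA', hd,
    modelDeriv_mul htp (mdifferentiableAt_fiberCoord hp),
    modelDeriv_comp rfl ht (mdifferentiableAt_proj p), fiberCoord_eq_transition_mul hp hp',
    map_add (modelRight IG _), modelRight_mul_right, modelRight_mul_left, mul_inv_rev,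
    modelAd_mul, ← add_assoc, sub_add_cancel, ← map_add (modelAd IG (B.transition e' e _)),
    modelAd_inv_modelAd]

/-- Along the orbit `π` is constant and the fibre coordinate is `a g`, so the bracket equals `Ad_a
L`. -/
theorem gaugeForm_fundamental {e : B.Triv} (A : M → EM →L[ℝ] EG) {p : P}
    (hp : B.proj p ∈ e.baseSet) (L : EG) :
    B.gaugeForm e A p (modelDeriv IG IP (fun g : G => B.act p g) 1 L) = L := by
  have h1 : modelDeriv IP IM B.proj p (modelDeriv IG IP (fun g : G => B.act p g) 1 L) = 0 := by
    rw [← modelDeriv_comp (B.act_one p) (mdifferentiableAt_proj p) (mdifferentiableAt_orbit p 1)]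
    simp only [B.proj_act, modelDeriv_const]
  have h2 : modelDeriv IP IG (B.fiberCoord e) p (modelDeriv IG IP (fun g : G => B.act p g) 1 L) =
      modelDeriv IG IG (fun g : G => B.fiberCoord e p * g) 1 L := by
    rw [← modelDeriv_comp (B.act_one p) (mdifferentiableAt_fiberCoord hp)
      (mdifferentiableAt_orbit p 1)]
    simp only [fiberCoord_act hp]
  have h3 := modelRight_mul_left (IG := IG) (B.fiberCoord e p) 1 L
  rw [mul_one] at h3
  rw [gaugeForm_apply, h1, h2, map_zero, zero_add, h3, modelRight_one, modelAd_inv_modelAd]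

/-- Right translation preserves both `dπ` and `da · a⁻¹`; only the factor `Ad_{a⁻¹}` changes, to
`Ad_{(a g)⁻¹}`. -/
theorem gaugeForm_act {e : B.Triv} (A : M → EM →L[ℝ] EG) {p : P}
    (hp : B.proj p ∈ e.baseSet) (g : G) (v : EP) :
    B.gaugeForm e A (B.act p g) (modelDeriv IP IP (fun q => B.act q g) p v) =
      modelAd IG g⁻¹ (B.gaugeForm e A p v) := by
  have hpg : B.proj (B.act p g) ∈ e.baseSet := by rw [B.proj_act]; exact hp
  have h1 : modelDeriv IP IM B.proj (B.act p g) (modelDeriv IP IP (fun q => B.act q g) p v) =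
      modelDeriv IP IM B.proj p v := by
    rw [← modelDeriv_comp rfl (mdifferentiableAt_proj _) (mdifferentiableAt_act g p)]
    simp only [B.proj_act]
  have h2 : modelDeriv IP IG (B.fiberCoord e) (B.act p g)
      (modelDeriv IP IP (fun q => B.act q g) p v) =
      modelDeriv IG IG (fun z : G => z * g) (B.fiberCoord e p)
        (modelDeriv IP IG (B.fiberCoord e) p v) := by
    rw [← modelDeriv_comp (f := fun q => B.act q g) rfl (mdifferentiableAt_fiberCoord hpg)
        (mdifferentiableAt_act g p),
      ← modelDeriv_comp rfl (mdifferentiableAt_mul_const _ _) (mdifferentiableAt_fiberCoord hp)]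
    refine congrArg (fun D : EP →L[ℝ] EG => D v) (modelDeriv_congr ?_)
    filter_upwards [eventually_proj_mem hp] with q hq
    exact fiberCoord_act hq g
  rw [gaugeForm_apply, gaugeForm_apply, h1, h2, fiberCoord_act hp, modelRight_mul_right,
    B.proj_act, mul_inv_rev, modelAd_mul]

variable [IsManifold IP ∞ P]

theorem contMDiff_fundamental :
    ContMDiff (IP.prod 𝓘(ℝ, EG)) IP.tangent ∞ (fun q : P × EG =>
      (⟨q.1, modelDeriv IG IP (fun g : G => B.act q.1 g) 1 q.2⟩ : TangentBundle IP P)) := by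
  have h := (contMDiff_partial_tangentMap B.contMDiff_act).comp
    ((contMDiff_fst (I := IP) (J := 𝓘(ℝ, EG)) (M := P) (N := EG)).prodMk
      ((contMDiff_tangentBundle_mk (I₂ := IG) (1 : G)).comp contMDiff_snd))
  convert h using 1
  funext q
  exact tangentBundle_mk_congr (B.act_one q.1).symm _

variable [IsManifold IM ∞ M]

theorem contMDiffOn_gaugeForm {e : B.Triv}
    {A : ∀ x : M, TangentSpace IM x →L[ℝ] GroupLieAlgebra IG G} (hA : IsSmoothOneFormOn A e.baseSet)
    {W : Set P} {X : ∀ p : P, TangentSpace IP p}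
    (hX : ContMDiffOn IP IP.tangent ∞ (fun p => (⟨p, X p⟩ : TangentBundle IP P)) W)
    (hWe : W ⊆ e.source) :
    ContMDiffOn IP 𝓘(ℝ, EG) ∞ (fun p => B.gaugeForm e A p (X p)) W := by
  have hproj : ContMDiffOn IP IM.tangent ∞
      (fun p => tangentMap IP IM B.proj (⟨p, X p⟩ : TangentBundle IP P)) W :=
    (B.contMDiff_proj.contMDiff_tangentMap (m := ∞) (by simp)).comp_contMDiffOn hX
  have h1 : ContMDiffOn IP 𝓘(ℝ, EG) ∞
      (fun p => (show EG from A (B.proj p) (modelDeriv IP IM B.proj p (X p)))) W :=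
    ContMDiffOn.comp hA hproj fun p hp => by
      have h := hWe hp
      rw [e.source_eq] at h
      exact h
  have hcoord : ContMDiffOn IP IG.tangent ∞ (fun p =>
      (⟨B.fiberCoord e p, modelDeriv IP IG (B.fiberCoord e) p (X p)⟩ : TangentBundle IG G)) W := by
    -- The fibre coordinate is smooth only on `π⁻¹(U)`; as this set is open, the differential within
    -- it is the ordinary one.
    have h2 := (contMDiffOn_fiberCoord e).contMDiffOn_tangentMapWithin (m := ∞) (by simp)
      e.open_source.uniqueMDiffOn
    refine (h2.comp hX hWe).congr fun p hp => ?_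
    simp only [Function.comp_apply, tangentMapWithin]
    rw [mfderivWithin_of_isOpen e.open_source (hWe hp)]
    rfl
  exact contMDiff_modelAd.comp_contMDiffOn
    (((contMDiffOn_fiberCoord e).mono hWe).inv.prodMk
      (h1.add (contMDiff_modelRight.comp_contMDiffOn hcoord)))

end LieGroup

end PrincipalBundle

/-! ### Connections and their forms -/

namespace PrincipalBundle

variable {B : PrincipalBundle IM IG IP M G P} [LieGroup IG ∞ G] [IsManifold IM ∞ M]
  [IsManifold IP ∞ P]

namespace Connection

theorem form_fundamental (C : B.Connection) (p : P) (L : GroupLieAlgebra IG G) :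
    C.form p (B.fundamental p L) = L := by
  have h1 : (B.vertical p).projectionOnto (C.horizontal p) (C.isCompl p).symm
      (B.fundamental p L) = B.verticalEquiv p L :=
    Submodule.projectionOnto_apply_left (C.isCompl p).symm (B.verticalEquiv p L)
  exact (congrArg (B.verticalEquiv p).symm h1).trans (LinearEquiv.symm_apply_apply _ L)

theorem ker_form (C : B.Connection) (p : P) : LinearMap.ker (C.form p) = C.horizontal p := by
  rw [form, LinearEquiv.ker_comp, Submodule.ker_projectionOnto]

theorem ext_of_form_eq {C C' : B.Connection} (h : ∀ p, C.form p = C'.form p) : C = C' :=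
  Connection.ext (funext fun p => by rw [← ker_form, ← ker_form, h p])

/-- A representing gauge potential determines the connection form over its domain. -/
theorem IsRepresentedBy.form_apply {C : B.Connection} {e : B.Triv}
    {A : ∀ x : M, TangentSpace IM x →L[ℝ] GroupLieAlgebra IG G} (hC : C.IsRepresentedBy e A)
    {p : P} (hp : B.proj p ∈ e.baseSet) (v : TangentSpace IP p) :
    C.form p v = B.gaugeForm e A p v := by
  have h1 := hC (B.proj p) hp (B.fiberCoord e p) (modelDeriv IP IM B.proj p v)
    (modelDeriv IP IG (B.fiberCoord e) p v)
  have h2 : e.toOpenPartialHomeomorph.symm (B.proj p, B.fiberCoord e p) = p := by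
    rw [← apply_eq_fiberCoord hp]; exact e.left_inv (mem_source_of_proj_mem hp)
  -- The type of the vector depends on the point, so both are replaced at once.
  have h3 : ∀ (q : P) (w : EP), q = p → w = v →
      (show EG from C.form q w) = (show EG from C.form p v) := by
    rintro q w rfl rfl; rfl
  exact (h3 _ _ h2 (modelDeriv_symm_apply hp v)).symm.trans h1

theorem isRepresentedBy_of_form_apply {C : B.Connection} {e : B.Triv}
    {A : ∀ x : M, TangentSpace IM x →L[ℝ] GroupLieAlgebra IG G}
    (hC : ∀ p, B.proj p ∈ e.baseSet → ∀ v : TangentSpace IP p,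
      C.form p v = B.gaugeForm e A p v) : C.IsRepresentedBy e A := fun x hx g ξ w =>
  (hC (e.toOpenPartialHomeomorph.symm (x, g)) (by rw [proj_symm_apply (y := (x, g)) hx]; exact hx)
    _).trans (gaugeForm_symm (EG := EG) A (y := (x, g)) hx (ξ, w))

/-- Equivariance sends horizontal vectors to horizontal vectors for every group element. Using this
for `g⁻¹` as well, with `R_g ∘ R_{g⁻¹} = id`, gives the reverse inclusion. -/
theorem isInvariant_of_form {C : B.Connection}
    (hC : ∀ (p : P) (g : G) (v : TangentSpace IP p),
      C.form (B.act p g) (B.dRight g p v) = adjointMap IG g⁻¹ (C.form p v)) : C.IsInvariant := by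
  intro p g
  have hsub : ∀ (q : P) (k : G), ∀ v ∈ C.horizontal q,
      B.dRight k q v ∈ C.horizontal (B.act q k) := by
    intro q k v hv
    rw [← ker_form, LinearMap.mem_ker] at hv ⊢
    rw [hC, hv, map_zero]
  have hcancel : ∀ w : EP, modelDeriv IP IP (fun q => B.act q g) p
      (modelDeriv IP IP (fun q => B.act q g⁻¹) (B.act p g) w) = w := by
    intro w
    rw [← modelDeriv_comp (f := fun q => B.act q g⁻¹) (g := fun q => B.act q g)
      (by rw [← B.act_mul, mul_inv_cancel, B.act_one]) (mdifferentiableAt_act g p)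
      (mdifferentiableAt_act g⁻¹ _)]
    simp only [← B.act_mul, inv_mul_cancel, B.act_one, modelDeriv_id]
  refine le_antisymm (fun w hw => ?_) (Submodule.map_le_iff_le_comap.2 (hsub p g))
  have h1 := hsub _ g⁻¹ w hw
  have h2 : ∀ (q : P) (u : EP), q = p → (show TangentSpace IP q from u) ∈ C.horizontal q →
      (show TangentSpace IP p from u) ∈ C.horizontal p := by
    rintro q u rfl h; exact h
  exact ⟨_, h2 _ _ (by rw [← B.act_mul, mul_inv_cancel, B.act_one]) h1, hcancel w⟩

/-- The connection whose horizontal subspaces are the kernels of a smooth `𝔤`-valued `1`-form which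
is inverse to `fundamental` on vertical vectors. -/
def ofForm (θ : ∀ p : P, TangentSpace IP p →L[ℝ] GroupLieAlgebra IG G)
    (hθ : ∀ p L, θ p (B.fundamental p L) = L)
    (hsmooth : ∀ (W : Set P) (X : ∀ p : P, TangentSpace IP p), IsOpen W →
      ContMDiffOn IP IP.tangent ∞ (fun p => (⟨p, X p⟩ : TangentBundle IP P)) W →
      ContMDiffOn IP 𝓘(ℝ, EG) ∞ (fun p => (show EG from θ p (X p))) W) : B.Connection where
  horizontal p := (θ p).ker
  isCompl p := by
    refine IsCompl.of_le (fun v hv => ?_) (fun v _ => ?_)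
    -- A vertical vector in the kernel is `L_p` with `L = θ (L_p) = 0`.
    · obtain ⟨L, rfl⟩ := B.exists_fundamental_eq p v hv.2
      have h : θ p (B.fundamental p L) = 0 := hv.1
      rw [hθ] at h
      rw [h, map_zero]; exact Submodule.zero_mem _
    · refine Submodule.mem_sup.2 ⟨v - B.fundamental p (θ p v), ?_, B.fundamental p (θ p v),
        B.fundamental_mem_vertical p _, sub_add_cancel _ _⟩
      exact LinearMap.mem_ker.2 (by simp [hθ])
  smooth W X hW hX := by
    -- The horizontal projection is `v ↦ v - θ(v)_p`, so it suffices that the vertical part of `X`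
    -- is smooth.
    have h1 : ContMDiffOn IP IP.tangent ∞
        (fun p => (⟨p, B.fundamental p (θ p (X p))⟩ : TangentBundle IP P)) W :=
      contMDiff_fundamental.comp_contMDiffOn (contMDiffOn_id.prodMk (hsmooth W X hW hX))
    refine (hX.sub_section h1).congr fun p _ => ?_
    have h2 : X p - B.fundamental p (θ p (X p)) ∈ (θ p).ker :=
      LinearMap.mem_ker.2 (by simp [hθ])
    exact congrArg (fun w : EP => (⟨p, w⟩ : TangentBundle IP P)) <|
      Submodule.projection_eq_sub_of_mem (E := TangentSpace IP p) _ h2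
        (B.fundamental_mem_vertical p _)

/-- The vector `v - θ(v)_p` is horizontal, hence killed by the connection form, which sends `θ(v)_p`
to `θ(v)`. -/
theorem ofForm_form (θ : ∀ p : P, TangentSpace IP p →L[ℝ] GroupLieAlgebra IG G)
    (hθ : ∀ p L, θ p (B.fundamental p L) = L)
    (hsmooth : ∀ (W : Set P) (X : ∀ p : P, TangentSpace IP p), IsOpen W →
      ContMDiffOn IP IP.tangent ∞ (fun p => (⟨p, X p⟩ : TangentBundle IP P)) W →
      ContMDiffOn IP 𝓘(ℝ, EG) ∞ (fun p => (show EG from θ p (X p))) W) (p : P)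
    (v : TangentSpace IP p) : (ofForm θ hθ hsmooth).form p v = θ p v := by
  have h1 : v - B.fundamental p (θ p v) ∈ (ofForm θ hθ hsmooth).horizontal p :=
    LinearMap.mem_ker.2 (by simp [hθ])
  rw [← ker_form, LinearMap.mem_ker, map_sub, form_fundamental, sub_eq_zero] at h1
  exact h1

end Connection

end PrincipalBundle

end PrincipalBundle

end

/-! ### Gluing the local forms -/

theorem mainTheorem11
    {EM : Type*} [NormedAddCommGroup EM] [NormedSpace ℝ EM] [FiniteDimensional ℝ EM]
    {HM : Type*} [TopologicalSpace HM] {IM : ModelWithCorners ℝ EM HM}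
    {EG : Type*} [NormedAddCommGroup EG] [NormedSpace ℝ EG] [FiniteDimensional ℝ EG]
    {HG : Type*} [TopologicalSpace HG] {IG : ModelWithCorners ℝ EG HG}
    {EP : Type*} [NormedAddCommGroup EP] [NormedSpace ℝ EP] [FiniteDimensional ℝ EP]
    {HP : Type*} [TopologicalSpace HP] {IP : ModelWithCorners ℝ EP HP}
    {M : Type*} [TopologicalSpace M] [ChartedSpace HM M] [IsManifold IM ∞ M]
    [BoundarylessManifold IM M] [T2Space M] [ParacompactSpace M]
    {G : Type*} [TopologicalSpace G] [ChartedSpace HG G] [Group G] [LieGroup IG ∞ G]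
    [BoundarylessManifold IG G] [T2Space G] [ParacompactSpace G]
    {P : Type*} [TopologicalSpace P] [ChartedSpace HP P] [IsManifold IP ∞ P]
    [BoundarylessManifold IP P] [T2Space P] [ParacompactSpace P]
    (B : PrincipalBundle IM IG IP M G P)
    {ι : Type*} (h : ι → B.Triv) (hcover : ∀ x : M, ∃ i, x ∈ (h i).baseSet)
    (A : ι → ∀ x : M, TangentSpace IM x →L[ℝ] GroupLieAlgebra IG G)
    (hA : ∀ i, IsSmoothOneFormOn (A i) (h i).baseSet)
    (hglue : ∀ i j, GaugeCompatible B (h j) (h i) (A j) (A i)) :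
    ∃! C : B.Connection, C.IsInvariant ∧ ∀ i, C.IsRepresentedBy (h i) (A i) := by
  
  -- The member chosen at `p` need not vary continuously with `p`; `hform` makes the choice
  -- immaterial.
  choose i hi using fun p : P => hcover (B.proj p)
  have hform : ∀ (p : P) (j : ι), B.proj p ∈ (h j).baseSet →
      B.gaugeForm (h (i p)) (A (i p)) p = B.gaugeForm (h j) (A j) p := fun p j hj =>
    PrincipalBundle.gaugeForm_eq_of_gaugeCompatible (hglue j (i p)) hj (hi p)
  set C : B.Connection := PrincipalBundle.Connection.ofForm
    (fun p => B.gaugeForm (h (i p)) (A (i p)) p)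
    (fun p L => PrincipalBundle.gaugeForm_fundamental (EG := EG) (A (i p)) (hi p) L) (by
      intro W X hW hX p hp
      -- Near `p` the glued form agrees with the formula for the single member `i p`, which is
      -- smooth.
      have hs : IsOpen (W ∩ (h (i p)).source) := hW.inter (h (i p)).open_source
      have hps : p ∈ W ∩ (h (i p)).source :=
        ⟨hp, PrincipalBundle.mem_source_of_proj_mem (hi p)⟩
      refine ContMDiffAt.contMDiffWithinAt (ContMDiffOn.contMDiffAt ?_ (hs.mem_nhds hps))
      refine (PrincipalBundle.contMDiffOn_gaugeForm (hA (i p))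
        (hX.mono Set.inter_subset_left) Set.inter_subset_right).congr fun q hq => ?_
      have hq2 := hq.2
      rw [(h (i p)).source_eq] at hq2
      exact DFunLike.congr_fun (hform q (i p) hq2) (X q)) with hC
  have hCform : ∀ (p : P) (v : TangentSpace IP p),
      C.form p v = B.gaugeForm (h (i p)) (A (i p)) p v :=
    fun p v => PrincipalBundle.Connection.ofForm_form _ _ _ p v
  refine ⟨C, ⟨PrincipalBundle.Connection.isInvariant_of_form fun p g v => ?_,
    fun j => PrincipalBundle.Connection.isRepresentedBy_of_form_apply fun p hp v => ?_⟩, ?_⟩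
  -- The member chosen at `p · g` may differ from `i p`, so it is exchanged before comparing.
  · rw [hCform, hCform, hform (B.act p g) (i p) (by rw [B.proj_act]; exact hi p)]
    exact PrincipalBundle.gaugeForm_act (EG := EG) _ (hi p) g v
  · rw [hCform, hform p j hp]
  · rintro C' ⟨-, hC'⟩
    refine PrincipalBundle.Connection.ext_of_form_eq fun p => LinearMap.ext fun v => ?_
    rw [hCform]
    exact (hC' (i p)).form_apply (hi p) v
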